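/- **Setting.** Let $1\le k<n$ and $q\ge 1$, let $X\in\mathbb R^{n\times k}$ have rank $k$, let $R\in\mathbb R^{q\times k}$ have rank $q$, and let $r\in\mathbb R^q$. Put $\mathfrak M_0=\{X\beta: R\beta=r\}$ and $\mathfrak M_1=\{X\beta: R\beta\ne r\}$, where $\beta$ ranges over $\mathbb R^k$, and let $\mathfrak M_0^{lin}$ be the linear space parallel to the affine space $\mathfrak M_0$. Let $\mathfrak C$ be a covariance model, i.e. a nonempty set of symmetric positive definite $n\times n$ matrices such that $\Sigma\in\mathfrak C$ implies $\delta\Sigma\notin\mathfrak C$ for every $\delta\ne1$. $P_{\mu,A}$ denotes the Gaussian measure on $\mathbb R^n$ with mean $\mu$ and covariance matrix $A$. $G(\mathfrak M_0)$ is the group of maps $y\mapsto\delta(y-a)+a^*$ with $\delta\neq0$ and $a,a^*\in\mathfrak M_0$. For a linear subspace $\mathcal S\subseteq\mathbb R^n$, $\lambda_{\mu_0+\mathcal S}$ is Lebesgue measure on the affine space $\mu_0+\mathcal S$, viewed as a Borel measure on $\mathbb R^n$. Let $T:\mathbb R^n\to\mathbb R$ be Borel-measurable and continuous on the complement of a closed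 set $N^\dagger\subseteq\mathbb R^n$. Assume that $T$ and $N^\dagger$ are invariant under $G(\mathfrak M_0)$ and under addition of elements of a linear subspace $\mathcal V\subseteq\mathbb R^n$. Let $\mathcal L=\operatorname{span}(\mathfrak M_0^{lin}\cup\mathcal V)$ and assume $\dim\mathcal L<n$. With $\Pi$ the orthogonal projection onto $\mathcal L^\perp$ and $\|\cdot\|$ a norm on $\mathbb R^{n\times n}$ (the choice is immaterial), put $\mathcal L(\Sigma)=\Pi\Sigma\Pi/\|\Pi\Sigma\Pi\|$ and $$\mathbb J=\{\operatorname{span}(\bar\Sigma):\bar\Sigma\in\operatorname{cl}\{\mathcal L(\Sigma):\Sigma\in\mathfrak C\},\ \operatorname{rank}\bar\Sigma<n-\dim\mathcal L\},$$ where $\operatorname{span}$ of a matrix is its column space and the closure is taken in $\mathbb R^{n\times n}$. Let $\mathbb H$ be the set of all $\mathcal S\in\mathbb J$ such that, for some $\mu_0\in\mathfrak M_0$ (and hence for all, with the same constant), $T$ equals a constant, denoted by $C(\mathcal S)$, $\lambda_{\mu_0+\mathcal S}$-almost everywhere. For $C\in\mathbb R$ consider the conditions $$\sup_{\mu_0\in\mathfrak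 M_0}\sup_{0<\sigma^2<\infty}\sup_{\Sigma\in\mathfrak C}P_{\mu_0,\sigma^2\Sigma}(T\ge C)<1,\tag{a}$$ $$\inf_{\mu_0\in\mathfrak M_0}\inf_{0<\sigma^2<\infty}\inf_{\Sigma\in\mathfrak C}P_{\mu_0,\sigma^2\Sigma}(T\ge C)=0.\tag{b}$$ Say that $\mathcal S\in\mathbb H$ is *regular* if $\lambda_{\mu_0+\mathcal S}(N^\dagger)=0$ for some $\mu_0\in\mathfrak M_0$. **Theorem.** If $\mathcal S\in\mathbb H$ is regular, then $\lambda_{\mu_0+\mathcal S}(N^\dagger)=0$ for all $\mu_0\in\mathfrak M_0$. Moreover: 1. If there are two regular elements $\mathcal S_1,\mathcal S_2$ of $\mathbb H$ with $C(\mathcal S_1)\ne C(\mathcal S_2)$, then every $C\in\mathbb R$ satisfying (a) satisfies (b). 2. If $\mathcal S\in\mathbb H$ is regular and $C\in\mathbb R$ satisfies (a), then $C\ge C(\mathcal S)$; if moreover $C\ne C(\mathcal S)$, then (b) holds. 3. If $C\in\mathbb R$ satisfies (b), then $$\inf_{0<\sigma^2<\infty}\inf_{\Sigma\in\mathfrak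 C}P_{\mu_1,\sigma^2\Sigma}(T\ge C)=0\quad\text{for every }\mu_1\in\mathfrak M_1,$$ $$\inf_{\mu_1\in\mathfrak M_1}\inf_{\Sigma\in\mathfrak C}P_{\mu_1,\sigma^2\Sigma}(T\ge C)=0\quad\text{for every }\sigma^2\in(0,\infty).$$ -/

import Mathlib

open MeasureTheory ProbabilityTheory
open scoped ENNReal Matrix

noncomputable section

namespace PowerAutocorr

/-- The sample space `ℝⁿ`. -/
abbrev E (n : ℕ) : Type := EuclideanSpace ℝ (Fin n)

/-- A covariance model: a nonempty set of symmetric positive definite `n × n` matrices such that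
`σ²` and `Σ` are determined by `σ² Σ`, i.e. no `δ Σ` with `δ ≠ 1` lies in the model. -/
structure IsCovarianceModel {n : ℕ} (𝒞 : Set (Matrix (Fin n) (Fin n) ℝ)) : Prop where
  nonempty : 𝒞.Nonempty
  posDef : ∀ S ∈ 𝒞, S.PosDef
  identified : ∀ S ∈ 𝒞, ∀ δ : ℝ, δ ≠ 1 → δ • S ∉ 𝒞

/-- The affine space of means satisfying the null hypothesis, `𝔐₀ = {X β : R β = r}`. Its
direction is the parallel linear space `𝔐₀ˡⁱⁿ`. -/
def nullMeans {n k q : ℕ} (X : Matrix (Fin n) (Fin k) ℝ) (R : Matrix (Fin q) (Fin k) ℝ)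
    (r : Fin q → ℝ) : AffineSubspace ℝ (E n) where
  carrier := {μ | ∃ β : Fin k → ℝ, μ = WithLp.toLp 2 (X *ᵥ β) ∧ R *ᵥ β = r}
  smul_vsub_vadd_mem' := by
    rintro c _ _ _ ⟨β₁, rfl, h₁⟩ ⟨β₂, rfl, h₂⟩ ⟨β₃, rfl, h₃⟩
    refine ⟨c • (β₁ - β₂) + β₃, ?_, ?_⟩
    · simp [Matrix.mulVec_add, Matrix.mulVec_smul, Matrix.mulVec_sub]
    · simp [Matrix.mulVec_add, Matrix.mulVec_smul, Matrix.mulVec_sub, h₁, h₂, h₃]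

/-- The set of means satisfying the alternative, `𝔐₁ = {X β : R β ≠ r}`. -/
def altMeans {n k q : ℕ} (X : Matrix (Fin n) (Fin k) ℝ) (R : Matrix (Fin q) (Fin k) ℝ)
    (r : Fin q → ℝ) : Set (E n) :=
  {μ | ∃ β : Fin k → ℝ, μ = WithLp.toLp 2 (X *ᵥ β) ∧ R *ᵥ β ≠ r}

/-- `G(𝒜)`: the transformations `y ↦ δ (y - a) + a'` of `ℝⁿ` with `δ ≠ 0` and `a, a' ∈ 𝒜`. -/
def affineGroup {n : ℕ} (A : AffineSubspace ℝ (E n)) : Set (E n → E n) :=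
  {g | ∃ δ : ℝ, δ ≠ 0 ∧ ∃ a ∈ A, ∃ a' ∈ A, g = fun y => δ • (y - a) + a'}

/-- The matrix of the orthogonal projection of `ℝⁿ` onto a linear subspace. -/
def projMatrix {n : ℕ} (L : Submodule ℝ (E n)) : Matrix (Fin n) (Fin n) ℝ :=
  (Matrix.toEuclideanCLM (n := Fin n) (𝕜 := ℝ)).symm L.starProjection

/-- `ℒ(Σ) = Π Σ Π / ‖Π Σ Π‖`, where `Π` projects onto `ℒᗮ` and the norm is the spectral norm. -/
def normalizedProj {n : ℕ} (L : Submodule ℝ (E n)) (S : Matrix (Fin n) (Fin n) ℝ) :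
    Matrix (Fin n) (Fin n) ℝ :=
  ‖Matrix.toEuclideanCLM (n := Fin n) (𝕜 := ℝ) (projMatrix Lᗮ * S * projMatrix Lᗮ)‖⁻¹ •
    (projMatrix Lᗮ * S * projMatrix Lᗮ)

/-- The column space of a matrix. -/
def colSpan {n : ℕ} (S : Matrix (Fin n) (Fin n) ℝ) : Submodule ℝ (E n) :=
  Submodule.span ℝ (Set.range fun j => (WithLp.toLp 2 (S.col j) : E n))

/-- `𝕁(ℒ, 𝒞)`: the column spaces of the limit points `S` in `cl {ℒ(Σ) : Σ ∈ 𝒞}` (closure in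
`ℝⁿˣⁿ`) with `rank S < n - dim ℒ`. -/
def limitSpaces {n : ℕ} (L : Submodule ℝ (E n)) (𝒞 : Set (Matrix (Fin n) (Fin n) ℝ)) :
    Set (Submodule ℝ (E n)) :=
  {W | ∃ S ∈ closure (normalizedProj L '' 𝒞), S.rank + Module.finrank ℝ L < n ∧ W = colSpan S}

/-- Lebesgue measure on the affine subspace `μ₀ + W`, as a Borel measure on `ℝⁿ`. -/
def affineLebesgue {n : ℕ} (μ₀ : E n) (W : Submodule ℝ (E n)) : Measure (E n) :=
  Measure.map (fun w : W => μ₀ + (w : E n)) volume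

/-- `T` equals `c` almost everywhere on `μ₀ + W` for some `μ₀ ∈ M₀`. -/
def AEConstOn {n : ℕ} (M₀ : AffineSubspace ℝ (E n)) (T : E n → ℝ) (W : Submodule ℝ (E n))
    (c : ℝ) : Prop :=
  ∃ μ₀ ∈ M₀, ∀ᵐ y ∂(affineLebesgue μ₀ W), T y = c

/-- `ℍ`: those spaces in `𝕁(ℒ, 𝒞)`, `ℒ = 𝔐₀ˡⁱⁿ + 𝒱`, on whose translates by elements of `𝔐₀` the
statistic `T` is almost everywhere constant. -/
def constSpaces {n : ℕ} (M₀ : AffineSubspace ℝ (E n)) (V : Submodule ℝ (E n))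
    (𝒞 : Set (Matrix (Fin n) (Fin n) ℝ)) (T : E n → ℝ) : Set (Submodule ℝ (E n)) :=
  {W | W ∈ limitSpaces (M₀.direction ⊔ V) 𝒞 ∧ ∃ c, AEConstOn M₀ T W c}

open Classical in
/-- `C(W)`: the almost sure value of `T` on the translates `μ₀ + W`, for `W` in `ℍ`. -/
def constValue {n : ℕ} (M₀ : AffineSubspace ℝ (E n)) (T : E n → ℝ) (W : Submodule ℝ (E n)) : ℝ :=
  if h : ∃ c, AEConstOn M₀ T W c then h.choose else 0

/-- Neither the choice of `μ₀` nor any other choice affects the constant: by invariance of `T` it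
is unique, so that `constValue` is well defined. -/
theorem constValue_eq {n : ℕ} {M₀ : AffineSubspace ℝ (E n)} {T : E n → ℝ} (hT : Measurable T)
    (hinv : ∀ g ∈ affineGroup M₀, ∀ y, T (g y) = T y) {W : Submodule ℝ (E n)} {c : ℝ}
    (hc : AEConstOn M₀ T W c) : constValue M₀ T W = c := by
  have h : ∃ c, AEConstOn M₀ T W c := ⟨c, hc⟩
  rw [constValue, dif_pos h]
  obtain ⟨a, ha, h₁⟩ := h.choose_spec
  obtain ⟨b, hb, h₂⟩ := hc
  have key : ∀ (a : E n) (d : ℝ), (∀ᵐ y ∂(affineLebesgue a W), T y = d) →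
      ∀ᵐ w : W ∂volume, T (a + (w : E n)) = d := by
    intro a d h
    rw [affineLebesgue, ae_map_iff (by fun_prop) (measurableSet_eq_fun hT measurable_const)] at h
    exact h
  obtain ⟨w, hw₁, hw₂⟩ := ((key a _ h₁).and (key b _ h₂)).exists
  have := hinv (fun y => (1 : ℝ) • (y - a) + b) ⟨1, one_ne_zero, a, ha, b, hb, rfl⟩
    (a + (w : E n))
  simp only [add_sub_cancel_left, one_smul] at this
  rw [← hw₁, ← hw₂, ← this, add_comm]

/-- The rejection probability `P_{μ, σ²Σ}(T ≥ C)`; the argument `v` is `σ²`. -/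
def rejProb {n : ℕ} (T : E n → ℝ) (C : ℝ) (μ : E n) (v : ℝ) (S : Matrix (Fin n) (Fin n) ℝ) :
    ℝ≥0∞ :=
  multivariateGaussian μ (v • S) {y | C ≤ T y}

/-- The size: the supremum of the rejection probabilities under the null hypothesis. -/
def size {n : ℕ} (M₀ : AffineSubspace ℝ (E n)) (𝒞 : Set (Matrix (Fin n) (Fin n) ℝ))
    (T : E n → ℝ) (C : ℝ) : ℝ≥0∞ :=
  ⨆ μ₀ ∈ M₀, ⨆ v ∈ Set.Ioi (0 : ℝ), ⨆ S ∈ 𝒞, rejProb T C μ₀ v S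

/-- The infimum of the rejection probabilities under the null hypothesis. -/
def nullInf {n : ℕ} (M₀ : AffineSubspace ℝ (E n)) (𝒞 : Set (Matrix (Fin n) (Fin n) ℝ))
    (T : E n → ℝ) (C : ℝ) : ℝ≥0∞ :=
  ⨅ μ₀ ∈ M₀, ⨅ v ∈ Set.Ioi (0 : ℝ), ⨅ S ∈ 𝒞, rejProb T C μ₀ v S

/-- The infimum over all `σ²` and `Σ` of the rejection probabilities at a fixed mean `μ₁`. -/
def powerInfAtMean {n : ℕ} (𝒞 : Set (Matrix (Fin n) (Fin n) ℝ)) (T : E n → ℝ) (C : ℝ)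
    (μ₁ : E n) : ℝ≥0∞ :=
  ⨅ v ∈ Set.Ioi (0 : ℝ), ⨅ S ∈ 𝒞, rejProb T C μ₁ v S

/-- The infimum over the means `μ₁ ∈ M₁` and over `Σ` of the rejection probabilities at a fixed
variance `σ² = v`. -/
def powerInfAtVariance {n : ℕ} (M₁ : Set (E n)) (𝒞 : Set (Matrix (Fin n) (Fin n) ℝ))
    (T : E n → ℝ) (C : ℝ) (v : ℝ) : ℝ≥0∞ :=
  ⨅ μ₁ ∈ M₁, ⨅ S ∈ 𝒞, rejProb T C μ₁ v S

end PowerAutocorr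

end

/-!
The invariance of `T` under `G(𝔐₀)` and under `𝒱` makes it invariant under translation by
`ℒ = 𝔐₀ˡⁱⁿ + 𝒱`, so under a null mean `a` the statistic only sees `Π (y - a)`, whose covariance
matrix `σ² Π Σ Π` may moreover be rescaled freely (`rejProb_eq_projected`). A space `W ∈ 𝕁` is the
column space of a limit `S` of such normalised matrices, and Gaussian measures depend weakly
continuously on their covariance matrix, singular limits included (`tendsto_gaussianPM`, from
Lévy's theorem). The limit law is absolutely continuous with respect to Lebesgue measure on `a + W`
(`multivariateGaussian_absolutelyContinuous`), where `T` is almost everywhere a constant `c` and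
where the exceptional set is null. By the portmanteau theorem, applied to the closed set
`N ∪ {T ≥ C}` or the open set `{T > C} \ N`, the rejection probabilities along the sequence then
tend to `0` if `C > c` (`nullInf_eq_zero_of_lt`) and to `1` if `C < c` (`one_le_size_of_lt`). This
gives the second part; in the first part `C` differs from one of the two constants.

For the third part, the group `G(𝔐₀)` acts transitively on the pairs `(μ₀, σ²)`, so a vanishing
null infimum is approached by varying `Σ` alone (`exists_rejProb_lt_of_nullInf_eq_zero`). For a
fixed nonsingular `Σ` the rejection probability is upper semicontinuous in the mean, by Fatou's
lemma for the Gaussian density (`exists_rejProb_add_lt`); no continuity of `T` is needed here. It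
remains to let an alternative mean approach `𝔐₀`: directly if `σ²` is fixed, and, if the mean is
fixed, through the homothety centred in `𝔐₀` that turns a large `σ²` into a small distance.
-/

namespace PowerAutocorr

open Filter Topology

/-! ### The standard Gaussian density -/

section Std

variable {F : Type*} [NormedAddCommGroup F] [InnerProductSpace ℝ F] [FiniteDimensional ℝ F]
  [MeasurableSpace F] [BorelSpace F]

/-- The density of the standard Gaussian measure. The normalising constant is left as the inverse
of an integral, as its value plays no role. -/
noncomputable def stdDensity (x : F) : ℝ :=
  (∫ y : F, Real.exp (-(1 / 2) * ‖y‖ ^ 2))⁻¹ * Real.exp (-(1 / 2) * ‖x‖ ^ 2)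

lemma continuous_stdDensity : Continuous (stdDensity : F → ℝ) := by
  unfold stdDensity; fun_prop

lemma stdDensity_nonneg (x : F) : 0 ≤ stdDensity x := by
  unfold stdDensity
  have : 0 ≤ ∫ y : F, Real.exp (-(1 / 2) * ‖y‖ ^ 2) := integral_nonneg fun _ => by positivity
  positivity

lemma integrable_exp_neg_half_sq_norm :
    Integrable (fun y : F => Real.exp (-(1 / 2) * ‖y‖ ^ 2)) := by
  have h := (GaussianFourier.integrable_cexp_neg_mul_sq_norm_add (V := F) (b := 1 / 2)
    (by norm_num) 0 0).re
  refine h.congr (ae_of_all _ fun y => ?_)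
  have : (-(1 / 2) * (‖y‖ : ℂ) ^ 2 + 0 * (inner ℝ (0 : F) y : ℝ)) =
      ((-(1 / 2) * ‖y‖ ^ 2 : ℝ) : ℂ) := by push_cast; ring
  change (Complex.exp _).re = _
  rw [this, ← Complex.ofReal_exp, Complex.ofReal_re]

theorem stdGaussian_eq_withDensity :
    stdGaussian F = volume.withDensity (fun x => ENNReal.ofReal (stdDensity x)) := by
  have hfin : IsFiniteMeasure (volume.withDensity fun x : F => ENNReal.ofReal (stdDensity x)) :=
    isFiniteMeasure_withDensity_ofReal
      (integrable_exp_neg_half_sq_norm.const_mul _).hasFiniteIntegral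
  refine Measure.ext_of_charFun (funext fun t => ?_)
  rw [charFun_stdGaussian, charFun_apply, integral_withDensity_eq_integral_toReal_smul
    (by have := continuous_stdDensity (F := F); fun_prop) (ae_of_all _ fun _ => ENNReal.ofReal_lt_top)]
  have key := GaussianFourier.integral_cexp_neg_mul_sq_norm_add (V := F) (b := 1 / 2)
    (by norm_num) Complex.I t
  have hc : ∫ y : F, Complex.exp (-(1 / 2) * (‖y‖ : ℂ) ^ 2) =
      ((∫ y : F, Real.exp (-(1 / 2) * ‖y‖ ^ 2) : ℝ) : ℂ) := by
    rw [← integral_complex_ofReal]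
    congr 1; ext y; push_cast; rfl
  have hpos : (∫ y : F, Real.exp (-(1 / 2) * ‖y‖ ^ 2)) ≠ 0 := by
    rw [GaussianFourier.integral_rexp_neg_mul_sq_norm (by norm_num)]
    positivity
  rw [← GaussianFourier.integral_cexp_neg_mul_sq_norm (by norm_num), hc] at key
  have : ∀ x : F, (ENNReal.ofReal (stdDensity x)).toReal •
      Complex.exp ((inner ℝ x t : ℝ) * Complex.I) =
      ((∫ y : F, Real.exp (-(1 / 2) * ‖y‖ ^ 2) : ℝ) : ℂ)⁻¹ *
        Complex.exp (-(1 / 2) * (‖x‖ : ℂ) ^ 2 + Complex.I * (inner ℝ t x : ℝ)) := by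
    intro x
    rw [ENNReal.toReal_ofReal (stdDensity_nonneg x), stdDensity, Complex.real_smul,
      real_inner_comm, Complex.exp_add]
    push_cast
    ring_nf
  simp_rw [this]
  rw [integral_const_mul, key, ← mul_assoc, inv_mul_cancel₀ (by exact_mod_cast hpos), one_mul,
    Complex.I_sq]
  congr 1; ring

lemma stdGaussian_absolutelyContinuous : stdGaussian F ≪ volume := by
  rw [stdGaussian_eq_withDensity]
  exact withDensity_absolutelyContinuous _ _

lemma stdGaussian_preimage_add_right {B : Set F} (hB : MeasurableSet B) (u : F) :
    stdGaussian F ((fun x => x + u) ⁻¹' B) = ∫⁻ x in B, ENNReal.ofReal (stdDensity (x - u)) := by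
  have hm : MeasurableSet ((fun x => x + u) ⁻¹' B) := (measurable_add_const u) hB
  rw [stdGaussian_eq_withDensity, withDensity_apply _ hm, ← lintegral_indicator hm,
    ← lintegral_indicator hB, ← lintegral_add_right_eq_self
      (B.indicator fun x => ENNReal.ofReal (stdDensity (x - u))) u]
  congr 1
  ext x
  simp only [Set.indicator, add_sub_cancel_right]
  rfl

/-- Lower semicontinuity of Gaussian probabilities of a fixed Borel set under translation, by
Fatou's lemma and continuity of the density. -/
lemma stdGaussian_le_liminf_translate {B : Set F} (hB : MeasurableSet B) {u : ℕ → F}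
    (hu : Tendsto u atTop (𝓝 0)) :
    stdGaussian F B ≤ liminf (fun m => stdGaussian F ((fun x => x + u m) ⁻¹' B)) atTop := by
  have h0 := stdGaussian_preimage_add_right hB 0
  simp only [add_zero, Set.preimage_id', sub_zero] at h0
  simp_rw [stdGaussian_preimage_add_right hB]
  rw [h0]
  have hc : Continuous fun x : F => ENNReal.ofReal (stdDensity x) :=
    ENNReal.continuous_ofReal.comp continuous_stdDensity
  refine le_trans (le_of_eq ?_)
    (lintegral_liminf_le fun m => (hc.comp (continuous_id.sub continuous_const)).measurable)
  congr 1
  ext x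
  have : Tendsto (fun m => ENNReal.ofReal (stdDensity (x - u m))) atTop
      (𝓝 (ENNReal.ofReal (stdDensity x))) := by
    have h1 : Tendsto (fun m => x - u m) atTop (𝓝 x) := by simpa using tendsto_const_nhds.sub hu
    exact (hc.tendsto x).comp h1
  exact this.liminf_eq.symm

/-- A Borel set that is not hit with large probability is not hit with large probability after
some small translation. Fatou's lemma is applied to the complement. -/
lemma exists_stdGaussian_translate_lt {B : Set F} (hB : MeasurableSet B) {u : ℕ → F}
    (hu : Tendsto u atTop (𝓝 0)) {ε : ℝ≥0∞} (hε : stdGaussian F B < ε) :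
    ∃ m, stdGaussian F ((fun x => x + u m) ⁻¹' B) < ε := by
  by_contra! h
  have h1 := stdGaussian_le_liminf_translate hB.compl hu
  have h2 : ∀ m, stdGaussian F ((fun x => x + u m) ⁻¹' Bᶜ) ≤ 1 - ε := by
    intro m
    rw [Set.preimage_compl, prob_compl_eq_one_sub ((measurable_add_const _) hB)]
    exact tsub_le_tsub_left (h m) 1
  have h3 : stdGaussian F Bᶜ ≤ 1 - ε :=
    h1.trans ((liminf_le_liminf (Eventually.of_forall h2)).trans (by simp))
  rw [prob_compl_eq_one_sub hB] at h3
  have h4 := tsub_le_tsub_left h3 1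
  rw [ENNReal.sub_sub_cancel ENNReal.one_ne_top ((h 0).trans prob_le_one),
    ENNReal.sub_sub_cancel ENNReal.one_ne_top prob_le_one] at h4
  exact absurd h4 (not_le.2 hε)

end Std

/-! ### Multivariate Gaussian measures -/

variable {n : ℕ}

open scoped MatrixOrder

lemma map_affine_multivariateGaussian {S : Matrix (Fin n) (Fin n) ℝ}
    (hS : S.PosSemidef) (A : Matrix (Fin n) (Fin n) ℝ) (μ b : E n) :
    (multivariateGaussian μ S).map
      (fun y => Matrix.toEuclideanCLM (n := Fin n) (𝕜 := ℝ) A y + b) =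
    multivariateGaussian (Matrix.toEuclideanCLM (n := Fin n) (𝕜 := ℝ) A μ + b) (A * S * Aᵀ) := by
  have hS' : (A * S * Aᵀ).PosSemidef := by
    simpa using hS.mul_mul_conjTranspose_same A
  have hm : Measurable (fun y => Matrix.toEuclideanCLM (n := Fin n) (𝕜 := ℝ) A y + b) := by
    fun_prop
  have := Measure.isProbabilityMeasure_map (μ := multivariateGaussian μ S) hm.aemeasurable
  refine Measure.ext_of_charFun (funext fun t => ?_)
  have hadj : ∀ y : E n, inner ℝ (Matrix.toEuclideanCLM (n := Fin n) (𝕜 := ℝ) A y) t =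
      inner ℝ y (Matrix.toEuclideanCLM (n := Fin n) (𝕜 := ℝ) Aᵀ t) := by
    intro y
    rw [real_inner_comm, Matrix.inner_toEuclideanCLM, Matrix.inner_toEuclideanCLM,
      Matrix.dotProduct_mulVec, ← Matrix.mulVec_transpose, dotProduct_comm]
  have hsplit : charFun ((multivariateGaussian μ S).map
      (fun y => Matrix.toEuclideanCLM (n := Fin n) (𝕜 := ℝ) A y + b)) t =
      charFun (multivariateGaussian μ S) (Matrix.toEuclideanCLM (n := Fin n) (𝕜 := ℝ) Aᵀ t) *
        Complex.exp ((inner ℝ b t : ℝ) * Complex.I) := by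
    rw [charFun_apply, charFun_apply, integral_map hm.aemeasurable (by fun_prop),
      ← integral_mul_const]
    congr 1
    ext y
    rw [inner_add_left, hadj, ← Complex.exp_add]
    push_cast; ring_nf
  rw [hsplit, charFun_multivariateGaussian hS, charFun_multivariateGaussian hS',
    ← Complex.exp_add, inner_add_right, real_inner_comm _ t, hadj, real_inner_comm b t,
    real_inner_comm μ]
  have hq : (Matrix.toEuclideanCLM (n := Fin n) (𝕜 := ℝ) Aᵀ t).ofLp ⬝ᵥ
      S *ᵥ (Matrix.toEuclideanCLM (n := Fin n) (𝕜 := ℝ) Aᵀ t).ofLp =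
      t.ofLp ⬝ᵥ (A * S * Aᵀ) *ᵥ t.ofLp := by
    rw [Matrix.ofLp_toEuclideanCLM, ← Matrix.mulVec_mulVec, ← Matrix.mulVec_mulVec,
      Matrix.dotProduct_mulVec t.ofLp A, Matrix.mulVec_transpose]
  rw [hq]
  push_cast
  ring_nf

/-- Positive semidefinite matrices form a closed set. -/
lemma posSemidef_of_tendsto {S : ℕ → Matrix (Fin n) (Fin n) ℝ} {S' : Matrix (Fin n) (Fin n) ℝ}
    (hS : ∀ m, (S m).PosSemidef) (h : Tendsto S atTop (𝓝 S')) : S'.PosSemidef := by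
  refine .of_dotProduct_mulVec_nonneg ?_ fun x => ?_
  · have h1 : Tendsto (fun m => (S m)ᴴ) atTop (𝓝 S'ᴴ) := by
      exact ((continuous_id.matrix_conjTranspose).tendsto S').comp h
    have h2 : (fun m => (S m)ᴴ) = S := funext fun m => (hS m).1
    rw [h2] at h1
    exact tendsto_nhds_unique h1 h
  · have hc : Continuous fun M : Matrix (Fin n) (Fin n) ℝ => star x ⬝ᵥ M *ᵥ x := by fun_prop
    exact ge_of_tendsto' ((hc.tendsto S').comp h) fun m => (hS m).dotProduct_mulVec_nonneg x

/-- The multivariate Gaussian measure as a bundled probability measure. -/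
noncomputable def gaussianPM (μ : E n) (S : Matrix (Fin n) (Fin n) ℝ) : ProbabilityMeasure (E n) :=
  ⟨multivariateGaussian μ S, inferInstance⟩

/-- Gaussian measures depend weakly continuously on the covariance matrix, up to and including
singular ones. -/
lemma tendsto_gaussianPM {S : ℕ → Matrix (Fin n) (Fin n) ℝ} {S' : Matrix (Fin n) (Fin n) ℝ}
    (hS : ∀ m, (S m).PosSemidef) (h : Tendsto S atTop (𝓝 S')) (μ : E n) :
    Tendsto (fun m => gaussianPM μ (S m)) atTop (𝓝 (gaussianPM μ S')) := by
  refine ProbabilityMeasure.tendsto_of_tendsto_charFun fun t => ?_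
  simp only [gaussianPM, ProbabilityMeasure.coe_mk]
  rw [charFun_multivariateGaussian (posSemidef_of_tendsto hS h)]
  simp_rw [fun m => charFun_multivariateGaussian (μ := μ) (hS m) t]
  have hc : Continuous fun M : Matrix (Fin n) (Fin n) ℝ =>
      Complex.exp ((inner ℝ t μ : ℝ) * Complex.I - ((t.ofLp ⬝ᵥ M *ᵥ t.ofLp : ℝ) : ℂ) / 2) := by
    fun_prop
  exact (hc.tendsto S').comp h

lemma colSpan_eq_range (S : Matrix (Fin n) (Fin n) ℝ) :
    colSpan S = LinearMap.range (Matrix.toEuclideanCLM (n := Fin n) (𝕜 := ℝ) S).toLinearMap := by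
  have h : (Matrix.toEuclideanCLM (n := Fin n) (𝕜 := ℝ) S).toLinearMap =
      ((WithLp.linearEquiv 2 ℝ (Fin n → ℝ)).symm.toLinearMap ∘ₗ S.mulVecLin) ∘ₗ
        (WithLp.linearEquiv 2 ℝ (Fin n → ℝ)).toLinearMap := by
    ext x i; rfl
  rw [h, LinearEquiv.range_comp, LinearMap.range_comp, Matrix.range_mulVecLin,
    Submodule.map_span, ← Set.range_comp]
  rfl

lemma range_sqrt_eq_colSpan {S : Matrix (Fin n) (Fin n) ℝ} (hS : S.PosSemidef) :
    LinearMap.range (Matrix.toEuclideanCLM (n := Fin n) (𝕜 := ℝ) (CFC.sqrt S)).toLinearMap =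
      colSpan S := by
  have hQ : CFC.sqrt S * CFC.sqrt S = S := CFC.sqrt_mul_sqrt_self S hS.nonneg
  have hle : colSpan S ≤ colSpan (CFC.sqrt S) := by
    rw [colSpan_eq_range, colSpan_eq_range]
    conv_lhs => rw [← hQ, map_mul]
    exact LinearMap.range_comp_le_range _ _
  have hrank : ∀ M : Matrix (Fin n) (Fin n) ℝ, Module.finrank ℝ (colSpan M) = M.rank := by
    intro M
    rw [colSpan, Matrix.rank_eq_finrank_span_cols]
    have : (Set.range fun j => (WithLp.toLp 2 (M.col j) : E n)) =
        (WithLp.linearEquiv 2 ℝ (Fin n → ℝ)).symm '' Set.range M.col := by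
      rw [← Set.range_comp]; rfl
    rw [this, ← LinearEquiv.coe_coe, ← Submodule.map_span]
    exact LinearEquiv.finrank_map_eq _ _
  rw [← colSpan_eq_range]
  refine (Submodule.eq_of_le_of_finrank_eq hle ?_).symm
  have hH : (CFC.sqrt S)ᴴ = CFC.sqrt S := (CFC.sqrt_nonneg S).isSelfAdjoint
  rw [hrank, hrank, ← Matrix.rank_conjTranspose_mul_self (CFC.sqrt S), hH, hQ]

/-- A Gaussian measure with a possibly singular covariance matrix `S` is absolutely continuous with
respect to Lebesgue measure on its supporting affine space `μ + colSpan S`. -/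
lemma multivariateGaussian_absolutelyContinuous {S : Matrix (Fin n) (Fin n) ℝ}
    (hS : S.PosSemidef) (μ : E n) :
    multivariateGaussian μ S ≪ affineLebesgue μ (colSpan S) := by
  set Q := (Matrix.toEuclideanCLM (n := Fin n) (𝕜 := ℝ) (CFC.sqrt S)).toLinearMap with hQ
  have hmem : ∀ x, Q x ∈ colSpan S := fun x => by
    rw [← range_sqrt_eq_colSpan hS]; exact ⟨x, rfl⟩
  let Q' : E n →ₗ[ℝ] colSpan S := Q.codRestrict _ hmem
  have hsurj : Function.Surjective Q' := by
    rintro ⟨y, hy⟩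
    rw [← range_sqrt_eq_colSpan hS] at hy
    obtain ⟨x, hx⟩ := hy
    exact ⟨x, Subtype.ext hx⟩
  have hQm : Measurable Q' := Q'.continuous_of_finiteDimensional.measurable
  have hm : Measurable (fun w : colSpan S => μ + (w : E n)) := by fun_prop
  have heq : multivariateGaussian μ S =
      ((stdGaussian (E n)).map Q').map (fun w : colSpan S => μ + (w : E n)) := by
    rw [Measure.map_map hm hQm]; rfl
  rw [heq, affineLebesgue]
  refine Measure.AbsolutelyContinuous.map ?_ hm
  obtain ⟨c, -, hc⟩ := Q'.exists_map_addHaar_eq_smul_addHaar volume volume hsurj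
  refine (stdGaussian_absolutelyContinuous.map hQm).trans ?_
  rw [hc]
  exact Measure.smul_absolutelyContinuous

/-! ### Invariance of the rejection probabilities -/

section Invariance

variable {M : AffineSubspace ℝ (E n)} {V : Submodule ℝ (E n)} {T : E n → ℝ}

lemma apply_add_eq_of_mem_sup (hne : (M : Set (E n)).Nonempty)
    (hTinv : ∀ g ∈ affineGroup M, ∀ y, T (g y) = T y) (hTV : ∀ v ∈ V, ∀ y, T (y + v) = T y)
    {l : E n} (hl : l ∈ M.direction ⊔ V) (y : E n) : T (y + l) = T y := by
  obtain ⟨d, hd, v, hv, rfl⟩ := Submodule.mem_sup.1 hl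
  rw [← add_assoc, hTV v hv]
  obtain ⟨a', ha', a, ha, rfl⟩ := (AffineSubspace.mem_direction_iff_eq_vsub hne d).1 hd
  have := hTinv (fun y => (1 : ℝ) • (y - a) + a') ⟨1, one_ne_zero, a, ha, a', ha', rfl⟩ y
  rw [← this, one_smul, vsub_eq_sub]
  congr 1; abel

/-- The null set condition does not depend on the mean. -/
lemma affineLebesgue_eq_zero_of_invariant {N : Set (E n)} (hN : MeasurableSet N)
    (hNinv : ∀ g ∈ affineGroup M, ∀ y, g y ∈ N ↔ y ∈ N) {W : Submodule ℝ (E n)} {a b : E n}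
    (ha : a ∈ M) (hb : b ∈ M) (h : affineLebesgue a W N = 0) : affineLebesgue b W N = 0 := by
  rw [affineLebesgue, Measure.map_apply (by fun_prop) hN] at h ⊢
  convert h using 2
  ext w
  have := hNinv (fun y => (1 : ℝ) • (y - a) + b) ⟨1, one_ne_zero, a, ha, b, hb, rfl⟩ (a + (w : E n))
  simp only [one_smul, add_sub_cancel_left] at this
  rw [Set.mem_preimage, Set.mem_preimage, ← this, add_comm]

lemma aeConstOn_forall (hT : Measurable T) (hTinv : ∀ g ∈ affineGroup M, ∀ y, T (g y) = T y)
    {W : Submodule ℝ (E n)} {c : ℝ} (h : AEConstOn M T W c) {b : E n} (hb : b ∈ M) :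
    affineLebesgue b W {y | T y ≠ c} = 0 := by
  obtain ⟨a, ha, h⟩ := h
  refine affineLebesgue_eq_zero_of_invariant
    (measurableSet_eq_fun hT measurable_const).compl (fun g hg y => ?_) ha hb h
  simp [hTinv g hg y]

lemma rejProb_eq_of_affineGroup (hT : Measurable T)
    (hTinv : ∀ g ∈ affineGroup M, ∀ y, T (g y) = T y) {S : Matrix (Fin n) (Fin n) ℝ}
    (hS : S.PosSemidef) {v δ : ℝ} (hv : 0 ≤ v) (hδ : δ ≠ 0) {a a' : E n} (ha : a ∈ M)
    (ha' : a' ∈ M) (C : ℝ) (μ : E n) :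
    rejProb T C (δ • (μ - a) + a') (δ ^ 2 * v) S = rejProb T C μ v S := by
  have hm : MeasurableSet {y | C ≤ T y} := measurableSet_le measurable_const hT
  have h := map_affine_multivariateGaussian (hS.smul hv)
    (δ • (1 : Matrix (Fin n) (Fin n) ℝ)) μ (a' - δ • a)
  have hf : ∀ y : E n, Matrix.toEuclideanCLM (n := Fin n) (𝕜 := ℝ)
      (δ • (1 : Matrix (Fin n) (Fin n) ℝ)) y + (a' - δ • a) = δ • (y - a) + a' := by
    intro y
    rw [map_smul, map_one, smul_sub]
    simp only [_root_.smul_apply, one_apply_eq_self]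
    abel
  have hM : δ • (1 : Matrix (Fin n) (Fin n) ℝ) * v • S * (δ • (1 : Matrix (Fin n) (Fin n) ℝ))ᵀ =
      (δ ^ 2 * v) • S := by
    simp [smul_smul]
    ring_nf
  simp_rw [hf, hM] at h
  rw [rejProb, ← h, Measure.map_apply (by fun_prop) hm, rejProb]
  congr 1
  ext y
  simp only [Set.mem_preimage, Set.mem_ofPred_eq]
  rw [hTinv (fun y => δ • (y - a) + a') ⟨δ, hδ, a, ha, a', ha', rfl⟩ y]

lemma toEuclideanCLM_projMatrix (L : Submodule ℝ (E n)) :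
    Matrix.toEuclideanCLM (n := Fin n) (𝕜 := ℝ) (projMatrix L) = L.starProjection := by
  simp [projMatrix]

lemma transpose_projMatrix (L : Submodule ℝ (E n)) : (projMatrix L)ᵀ = projMatrix L := by
  have h : star (projMatrix L) = projMatrix L := by
    refine EquivLike.injective (Matrix.toEuclideanCLM (n := Fin n) (𝕜 := ℝ)) ?_
    rw [map_star, toEuclideanCLM_projMatrix, (isSelfAdjoint_starProjection L).star_eq]
  rwa [Matrix.star_eq_conjTranspose, Matrix.conjTranspose_eq_transpose_of_trivial] at h

/-- Under the null hypothesis `Σ` may be replaced by the covariance matrix of the projected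
data. -/
lemma rejProb_eq_projected (hT : Measurable T) (hne : (M : Set (E n)).Nonempty)
    (hTinv : ∀ g ∈ affineGroup M, ∀ y, T (g y) = T y) (hTV : ∀ v ∈ V, ∀ y, T (y + v) = T y)
    {S : Matrix (Fin n) (Fin n) ℝ} (hS : S.PosSemidef) {v : ℝ} (hv : 0 ≤ v) (C : ℝ) (a : E n) :
    rejProb T C a v S = multivariateGaussian a
      (v • (projMatrix (M.direction ⊔ V)ᗮ * S * projMatrix (M.direction ⊔ V)ᗮ))
        {y | C ≤ T y} := by
  set L := M.direction ⊔ V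
  have hm : MeasurableSet {y | C ≤ T y} := measurableSet_le measurable_const hT
  have h := map_affine_multivariateGaussian (hS.smul hv) (projMatrix Lᗮ) a
    (a - Lᗮ.starProjection a)
  rw [transpose_projMatrix, toEuclideanCLM_projMatrix, add_sub_cancel] at h
  have hM : projMatrix Lᗮ * v • S * projMatrix Lᗮ = v • (projMatrix Lᗮ * S * projMatrix Lᗮ) := by
    simp
  rw [← hM, ← h, Measure.map_apply (by fun_prop) hm, rejProb]
  congr 1
  ext y
  have hl : L.starProjection (y - a) ∈ M.direction ⊔ V := Submodule.starProjection_apply_mem _ _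
  have hy : y = Lᗮ.starProjection y + (a - Lᗮ.starProjection a) + L.starProjection (y - a) := by
    have h1 := L.starProjection_add_starProjection_orthogonal (y - a)
    rw [map_sub Lᗮ.starProjection] at h1
    calc y = a + (y - a) := by abel
      _ = a + (L.starProjection (y - a) + (Lᗮ.starProjection y - Lᗮ.starProjection a)) := by
        rw [h1]
      _ = _ := by abel
  simp only [Set.mem_preimage, Set.mem_ofPred_eq]
  conv_lhs => rw [hy, apply_add_eq_of_mem_sup hne hTinv hTV hl]

end Invariance

/-! ### Concentration along a sequence of covariance matrices -/

lemma norm_projected_pos {L : Submodule ℝ (E n)} (hL : Module.finrank ℝ L < n)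
    {S : Matrix (Fin n) (Fin n) ℝ} (hS : S.PosDef) :
    0 < ‖Matrix.toEuclideanCLM (n := Fin n) (𝕜 := ℝ) (projMatrix Lᗮ * S * projMatrix Lᗮ)‖ := by
  have hbot : Lᗮ ≠ ⊥ := by
    intro h
    have h1 := Submodule.orthogonal_eq_bot_iff.1 h
    rw [h1, finrank_top] at hL
    simp at hL
  obtain ⟨x, hx, hx0⟩ := Submodule.exists_mem_ne_zero_of_ne_bot hbot
  refine norm_pos_iff.2 fun h0 => ?_
  have h1 : inner ℝ x (Matrix.toEuclideanCLM (n := Fin n) (𝕜 := ℝ)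
      (projMatrix Lᗮ * S * projMatrix Lᗮ) x) = 0 := by rw [h0]; simp
  have hpx : Lᗮ.starProjection x = x := Submodule.starProjection_eq_self_iff.2 hx
  rw [map_mul, map_mul, toEuclideanCLM_projMatrix, mul_apply_eq_comp,
    mul_apply_eq_comp, ← Submodule.inner_starProjection_left_eq_right, hpx,
    Matrix.inner_toEuclideanCLM] at h1
  have hx0' : x.ofLp ≠ 0 := fun h => hx0 (by ext i; simp [h])
  have := hS.dotProduct_mulVec_pos hx0'
  simp only [star_trivial] at this
  exact this.ne' h1

/-- Along a suitable sequence of null distributions the law of `T`, up to its invariances,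
converges to a Gaussian law carried by `a + W`. -/
lemma exists_gaussianPM_tendsto {M : AffineSubspace ℝ (E n)} {V : Submodule ℝ (E n)}
    {𝒞 : Set (Matrix (Fin n) (Fin n) ℝ)} {T : E n → ℝ} (h𝒞 : ∀ S ∈ 𝒞, S.PosDef)
    (hT : Measurable T) (hTinv : ∀ g ∈ affineGroup M, ∀ y, T (g y) = T y)
    (hTV : ∀ v ∈ V, ∀ y, T (y + v) = T y)
    (hdim : Module.finrank ℝ ↥(M.direction ⊔ V) < n) {W : Submodule ℝ (E n)}
    (hW : W ∈ limitSpaces (M.direction ⊔ V) 𝒞) {a : E n} (ha : a ∈ M) :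
    ∃ (P : ℕ → ProbabilityMeasure (E n)) (Q : ProbabilityMeasure (E n)),
      Tendsto P atTop (𝓝 Q) ∧ (Q : Measure (E n)) ≪ affineLebesgue a W ∧
      ∀ m, ∃ v ∈ Set.Ioi (0 : ℝ), ∃ S ∈ 𝒞, ∀ C,
        rejProb T C a v S = (P m : Measure (E n)) {y | C ≤ T y} := by
  obtain ⟨S', hS', -, rfl⟩ := hW
  have : FrechetUrysohnSpace (Matrix (Fin n) (Fin n) ℝ) :=
    inferInstanceAs (FrechetUrysohnSpace (Fin n → Fin n → ℝ))
  obtain ⟨s, hs, hlim⟩ := mem_closure_iff_seq_limit.1 hS'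
  choose S hSC hSs using hs
  obtain rfl : (fun m => normalizedProj (M.direction ⊔ V) (S m)) = s := funext hSs
  have hpsd : ∀ m, (normalizedProj (M.direction ⊔ V) (S m)).PosSemidef := by
    intro m
    have := (h𝒞 _ (hSC m)).posSemidef.mul_mul_conjTranspose_same (projMatrix (M.direction ⊔ V)ᗮ)
    rw [Matrix.conjTranspose_eq_transpose_of_trivial, transpose_projMatrix] at this
    exact this.smul (inv_nonneg.2 (norm_nonneg _))
  refine ⟨_, _, tendsto_gaussianPM hpsd hlim a,
    multivariateGaussian_absolutelyContinuous (posSemidef_of_tendsto hpsd hlim) a, fun m => ?_⟩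
  -- The variance `σ² = 1 / ‖Π Σ Π‖` turns `Π Σ Π` into its normalised version.
  have hpos := inv_pos.2 (norm_projected_pos hdim (h𝒞 _ (hSC m)))
  exact ⟨_, hpos, S m, hSC m, fun C => rejProb_eq_projected hT ⟨a, ha⟩ hTinv hTV
    (h𝒞 _ (hSC m)).posSemidef hpos.le C a⟩

section Concentration

variable {M : AffineSubspace ℝ (E n)} {V : Submodule ℝ (E n)}
  {𝒞 : Set (Matrix (Fin n) (Fin n) ℝ)} {T : E n → ℝ} {N : Set (E n)}
  {W : Submodule ℝ (E n)}

/-- A critical value above the concentration value makes the rejection probabilities under the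
null hypothesis degenerate to zero. -/
lemma nullInf_eq_zero_of_lt (h𝒞 : ∀ S ∈ 𝒞, S.PosDef)
    (hT : Measurable T) (hNclosed : IsClosed N) (hTcont : ContinuousOn T Nᶜ)
    (hTinv : ∀ g ∈ affineGroup M, ∀ y, T (g y) = T y)
    (hTV : ∀ v ∈ V, ∀ y, T (y + v) = T y)
    (hdim : Module.finrank ℝ ↥(M.direction ⊔ V) < n)
    (hW : W ∈ limitSpaces (M.direction ⊔ V) 𝒞) {a : E n} (ha : a ∈ M)
    (hN : affineLebesgue a W N = 0) {c C : ℝ} (hc : affineLebesgue a W {y | T y ≠ c} = 0)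
    (hC : c < C) : nullInf M 𝒞 T C = 0 := by
  obtain ⟨P, Q, hPQ, hQ, hP⟩ := exists_gaussianPM_tendsto h𝒞 hT hTinv hTV hdim hW ha
  -- `{T ≥ C}` need not be closed, but adjoining `N` closes it.
  have hF : IsClosed (N ∪ {y | C ≤ T y}) := by
    have h := hTcont.isOpen_inter_preimage hNclosed.isOpen_compl (isOpen_Iio (a := C))
    convert h.isClosed_compl using 1
    ext y
    simp only [Set.mem_union, Set.mem_ofPred_eq, Set.mem_compl_iff, Set.mem_inter_iff,
      Set.mem_preimage, Set.mem_Iio, not_and, not_lt]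
    tauto
  have hQF : (Q : Measure (E n)) (N ∪ {y | C ≤ T y}) = 0 := by
    refine measure_union_null (hQ hN) (hQ (measure_mono_null (fun y hy => ?_) hc))
    exact (hC.trans_le hy).ne'
  have hlim := ProbabilityMeasure.limsup_measure_closed_le_of_tendsto hPQ hF
  rw [hQF] at hlim
  refine le_antisymm (le_trans ?_ hlim) bot_le
  refine le_limsup_of_le ?_ fun b hb => ?_
  · isBoundedDefault
  · obtain ⟨m, hm⟩ := hb.exists
    obtain ⟨v, hv, S, hS, h⟩ := hP m
    calc nullInf M 𝒞 T C ≤ rejProb T C a v S := iInf₂_le_of_le a ha <|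
          iInf₂_le_of_le v hv <| iInf₂_le S hS
      _ ≤ b := (h C).trans_le ((measure_mono Set.subset_union_right).trans hm)

/-- A critical value below the concentration value makes the size equal to one. -/
lemma one_le_size_of_lt (h𝒞 : ∀ S ∈ 𝒞, S.PosDef)
    (hT : Measurable T) (hNclosed : IsClosed N) (hTcont : ContinuousOn T Nᶜ)
    (hTinv : ∀ g ∈ affineGroup M, ∀ y, T (g y) = T y)
    (hTV : ∀ v ∈ V, ∀ y, T (y + v) = T y)
    (hdim : Module.finrank ℝ ↥(M.direction ⊔ V) < n)
    (hW : W ∈ limitSpaces (M.direction ⊔ V) 𝒞) {a : E n} (ha : a ∈ M)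
    (hN : affineLebesgue a W N = 0) {c C : ℝ} (hc : affineLebesgue a W {y | T y ≠ c} = 0)
    (hC : C < c) : 1 ≤ size M 𝒞 T C := by
  obtain ⟨P, Q, hPQ, hQ, hP⟩ := exists_gaussianPM_tendsto h𝒞 hT hTinv hTV hdim hW ha
  have hG : IsOpen (Nᶜ ∩ T ⁻¹' Set.Ioi C) :=
    hTcont.isOpen_inter_preimage hNclosed.isOpen_compl isOpen_Ioi
  have hQG : (Q : Measure (E n)) (Nᶜ ∩ T ⁻¹' Set.Ioi C) = 1 := by
    rw [prob_compl_eq_zero_iff hG.measurableSet |>.symm, Set.compl_inter, compl_compl]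
    refine measure_union_null (hQ hN) (hQ (measure_mono_null (fun y hy => ?_) hc))
    rw [Set.mem_ofPred_eq]
    rintro rfl
    exact hy hC
  have hlim := ProbabilityMeasure.le_liminf_measure_open_of_tendsto hPQ hG
  rw [hQG] at hlim
  refine hlim.trans (liminf_le_of_le (by isBoundedDefault) fun b hb => ?_)
  obtain ⟨m, hm⟩ := hb.exists
  obtain ⟨v, hv, S, hS, h⟩ := hP m
  calc b ≤ (P m : Measure (E n)) (Nᶜ ∩ T ⁻¹' Set.Ioi C) := hm
    _ ≤ rejProb T C a v S := by
      rw [h C]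
      exact measure_mono fun y hy => show C ≤ T y from le_of_lt hy.2
    _ ≤ size M 𝒞 T C := le_iSup₂_of_le a ha <| le_iSup₂_of_le v hv <|
        le_iSup₂ (f := fun S _ => rejProb T C a v S) S hS

end Concentration

/-! ### From the null hypothesis to the alternative -/

/-- For a fixed nonsingular covariance matrix the rejection probability does not jump up when the
mean is perturbed slightly. -/
lemma exists_rejProb_add_lt {T : E n → ℝ} (hT : Measurable T) {S : Matrix (Fin n) (Fin n) ℝ}
    (hS : S.PosDef) {v : ℝ} (hv : 0 < v) (C : ℝ) (μ : E n) {d : ℕ → E n}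
    (hd : Tendsto d atTop (𝓝 0)) {ε : ℝ≥0∞} (hε : rejProb T C μ v S < ε) :
    ∃ m, rejProb T C (μ + d m) v S < ε := by
  have hS' : (v • S).PosDef := hS.smul hv
  set A := CFC.sqrt (v • S) with hA
  set B := {y | C ≤ T y}
  have hB : MeasurableSet B := measurableSet_le measurable_const hT
  have hAA : A * A = v • S := CFC.sqrt_mul_sqrt_self _ hS'.posSemidef.nonneg
  have hu : IsUnit A.det := by
    have h : IsUnit (A * A).det := by rw [hAA]; exact hS'.isUnit.map Matrix.detMonoidHom
    rw [Matrix.det_mul] at h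
    exact isUnit_of_mul_isUnit_left h
  set A' := Matrix.toEuclideanCLM (n := Fin n) (𝕜 := ℝ) A
  set I' := Matrix.toEuclideanCLM (n := Fin n) (𝕜 := ℝ) A⁻¹
  have hAI : ∀ x, A' (I' x) = x := by
    intro x
    rw [← mul_apply_eq_comp, ← map_mul, Matrix.mul_nonsing_inv _ hu, map_one]
    rfl
  have hrej : ∀ ν, rejProb T C ν v S = stdGaussian (E n) ((fun x => ν + A' x) ⁻¹' B) := by
    intro ν
    rw [rejProb, multivariateGaussian, Measure.map_apply (by fun_prop) hB]
  rw [hrej] at hε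
  have hId : Tendsto (fun m => I' (d m)) atTop (𝓝 0) := by
    have h := (I'.continuous.tendsto 0).comp hd
    rwa [map_zero] at h
  obtain ⟨m, hm⟩ := exists_stdGaussian_translate_lt
    ((by fun_prop : Measurable fun x => μ + A' x) hB) hId hε
  refine ⟨m, ?_⟩
  rw [hrej]
  convert hm using 2
  ext x
  simp only [Set.mem_preimage, map_add, hAI, add_assoc, add_comm (d m)]

section Alternative

variable {M : AffineSubspace ℝ (E n)} {𝒞 : Set (Matrix (Fin n) (Fin n) ℝ)} {T : E n → ℝ}

/-- If the null rejection probabilities come arbitrarily close to zero, they do so at any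
prescribed null mean and variance, by varying the covariance matrix alone. -/
lemma exists_rejProb_lt_of_nullInf_eq_zero (h𝒞 : ∀ S ∈ 𝒞, S.PosDef) (hT : Measurable T)
    (hTinv : ∀ g ∈ affineGroup M, ∀ y, T (g y) = T y) {C : ℝ} (h : nullInf M 𝒞 T C = 0)
    {a : E n} (ha : a ∈ M) {v : ℝ} (hv : 0 < v) {ε : ℝ≥0∞} (hε : 0 < ε) :
    ∃ S ∈ 𝒞, rejProb T C a v S < ε := by
  rw [← h, nullInf] at hε
  simp only [iInf_lt_iff] at hε
  obtain ⟨b, hb, w, hw, S, hS, hlt⟩ := hε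
  have hw' : 0 < w := hw
  refine ⟨S, hS, ?_⟩
  have hδ : √(v / w) ≠ 0 := (Real.sqrt_pos.2 (div_pos hv hw')).ne'
  have := rejProb_eq_of_affineGroup hT hTinv (h𝒞 S hS).posSemidef hw'.le hδ hb ha C b
  rw [Real.sq_sqrt (div_pos hv hw').le, div_mul_cancel₀ _ hw'.ne', sub_self, smul_zero,
    zero_add] at this
  rwa [this]

/-- Vanishing of the null infimum propagates to every fixed mean: blowing up the variance is, by
invariance, the same as moving the mean towards the null hypothesis. -/
lemma powerInfAtMean_eq_zero (h𝒞 : ∀ S ∈ 𝒞, S.PosDef) (hT : Measurable T)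
    (hTinv : ∀ g ∈ affineGroup M, ∀ y, T (g y) = T y) {C : ℝ} (h : nullInf M 𝒞 T C = 0)
    (hne : (M : Set (E n)).Nonempty) (μ : E n) : powerInfAtMean 𝒞 T C μ = 0 := by
  obtain ⟨a, ha⟩ := hne
  refine le_antisymm (le_of_forall_gt fun ε hε => ?_) bot_le
  obtain ⟨S, hS, hlt⟩ := exists_rejProb_lt_of_nullInf_eq_zero h𝒞 hT hTinv h ha one_pos hε
  have hd : Tendsto (fun m : ℕ => (1 / ((m : ℝ) + 1)) • (μ - a)) atTop (𝓝 0) := by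
    simpa using (tendsto_one_div_add_atTop_nhds_zero_nat (𝕜 := ℝ)).smul_const (μ - a)
  obtain ⟨m, hm⟩ := exists_rejProb_add_lt hT (h𝒞 S hS) one_pos C a hd hlt
  have hpos : (0 : ℝ) < (m : ℝ) + 1 := by positivity
  have hδ : (m : ℝ) + 1 ≠ 0 := hpos.ne'
  have := rejProb_eq_of_affineGroup hT hTinv (h𝒞 S hS).posSemidef zero_le_one hδ ha ha C
    (a + (1 / ((m : ℝ) + 1)) • (μ - a))
  rw [add_sub_cancel_left, smul_smul, mul_one_div_cancel hδ, one_smul, sub_add_cancel] at this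
  rw [← this] at hm
  exact lt_of_le_of_lt (iInf₂_le_of_le _ (show (0 : ℝ) < _ by positivity) (iInf₂_le S hS)) hm

/-- Vanishing of the null infimum propagates to every fixed variance, once the means of the
alternative accumulate at a mean of the null hypothesis. -/
lemma powerInfAtVariance_eq_zero (h𝒞 : ∀ S ∈ 𝒞, S.PosDef) (hT : Measurable T)
    (hTinv : ∀ g ∈ affineGroup M, ∀ y, T (g y) = T y) {C : ℝ} (h : nullInf M 𝒞 T C = 0)
    {M₁ : Set (E n)} {a : E n} (ha : a ∈ M) {d : ℕ → E n} (hd : Tendsto d atTop (𝓝 0))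
    (hd₁ : ∀ m, a + d m ∈ M₁) {v : ℝ} (hv : 0 < v) : powerInfAtVariance M₁ 𝒞 T C v = 0 := by
  refine le_antisymm (le_of_forall_gt fun ε hε => ?_) bot_le
  obtain ⟨S, hS, hlt⟩ := exists_rejProb_lt_of_nullInf_eq_zero h𝒞 hT hTinv h ha hv hε
  obtain ⟨m, hm⟩ := exists_rejProb_add_lt hT (h𝒞 S hS) hv C a hd hlt
  exact lt_of_le_of_lt (iInf₂_le_of_le _ (hd₁ m) (iInf₂_le S hS)) hm

end Alternative

/-! ### Linear restrictions on the mean -/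

section Linear

variable {k q : ℕ} (X : Matrix (Fin n) (Fin k) ℝ) {R : Matrix (Fin q) (Fin k) ℝ}

lemma mulVec_surjective_of_rank_eq (hR : R.rank = q) : Function.Surjective (R *ᵥ ·) := by
  have : LinearMap.range R.mulVecLin = ⊤ := by
    refine Submodule.eq_top_of_finrank_eq ?_
    rw [Module.finrank_fin_fun]
    exact hR
  exact LinearMap.range_eq_top.1 this

lemma nullMeans_nonempty (hR : R.rank = q) (r : Fin q → ℝ) :
    (nullMeans X R r : Set (E n)).Nonempty := by
  obtain ⟨β, hβ⟩ := mulVec_surjective_of_rank_eq hR r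
  exact ⟨_, β, rfl, hβ⟩

lemma exists_altMeans_seq (hq : 1 ≤ q) (hR : R.rank = q) (r : Fin q → ℝ) {a : E n}
    (ha : a ∈ nullMeans X R r) :
    ∃ d : ℕ → E n, Tendsto d atTop (𝓝 0) ∧ ∀ m, a + d m ∈ altMeans X R r := by
  obtain ⟨β, rfl, hβ⟩ := ha
  obtain ⟨γ, hγ⟩ := mulVec_surjective_of_rank_eq hR (fun _ => (1 : ℝ))
  refine ⟨fun m => (1 / ((m : ℝ) + 1)) • WithLp.toLp 2 (X *ᵥ γ), ?_, fun m => ?_⟩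
  · simpa using (tendsto_one_div_add_atTop_nhds_zero_nat (𝕜 := ℝ)).smul_const
      (WithLp.toLp 2 (X *ᵥ γ) : E n)
  · refine ⟨β + (1 / ((m : ℝ) + 1)) • γ, ?_, fun h => ?_⟩
    · rw [Matrix.mulVec_add, Matrix.mulVec_smul]; rfl
    · simp only at hγ
      rw [Matrix.mulVec_add, Matrix.mulVec_smul, hβ, hγ] at h
      have h0 := congrFun h ⟨0, hq⟩
      simp only [Pi.add_apply, Pi.smul_apply, smul_eq_mul, mul_one, add_eq_left] at h0
      exact (by positivity : (1 / ((m : ℝ) + 1)) ≠ 0) h0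

end Linear

end PowerAutocorr

/-! ### Size and power -/

open PowerAutocorr in
theorem theorem4p2 {n k q : ℕ} (hk : 1 ≤ k) (hkn : k < n) (hq : 1 ≤ q)
    (X : Matrix (Fin n) (Fin k) ℝ) (hX : X.rank = k)
    (R : Matrix (Fin q) (Fin k) ℝ) (hR : R.rank = q) (r : Fin q → ℝ)
    (𝒞 : Set (Matrix (Fin n) (Fin n) ℝ)) (h𝒞 : IsCovarianceModel 𝒞)
    (T : E n → ℝ) (hTmeas : Measurable T)
    (N : Set (E n)) (hNclosed : IsClosed N) (hTcont : ContinuousOn T Nᶜ)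
    (hTinv : ∀ g ∈ affineGroup (nullMeans X R r), ∀ y, T (g y) = T y)
    (hNinv : ∀ g ∈ affineGroup (nullMeans X R r), ∀ y, g y ∈ N ↔ y ∈ N)
    (V : Submodule ℝ (E n))
    (hTV : ∀ v ∈ V, ∀ y, T (y + v) = T y)
    (hNV : ∀ v ∈ V, ∀ y, y + v ∈ N ↔ y ∈ N)
    (hdim : Module.finrank ℝ ↥((nullMeans X R r).direction ⊔ V) < n) :
    -- the null set condition for one mean in the null hypothesis gives it for all of them
    (∀ W ∈ constSpaces (nullMeans X R r) V 𝒞 T,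
      (∃ μ₀ ∈ nullMeans X R r, affineLebesgue μ₀ W N = 0) →
        ∀ μ₀ ∈ nullMeans X R r, affineLebesgue μ₀ W N = 0) ∧
    -- Part 1
    (∀ W₁ ∈ constSpaces (nullMeans X R r) V 𝒞 T, ∀ W₂ ∈ constSpaces (nullMeans X R r) V 𝒞 T,
      constValue (nullMeans X R r) T W₁ ≠ constValue (nullMeans X R r) T W₂ →
      (∃ μ₀ ∈ nullMeans X R r, affineLebesgue μ₀ W₁ N = 0) →
      (∃ μ₀ ∈ nullMeans X R r, affineLebesgue μ₀ W₂ N = 0) →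
      ∀ C : ℝ, size (nullMeans X R r) 𝒞 T C < 1 → nullInf (nullMeans X R r) 𝒞 T C = 0) ∧
    -- Part 2
    (∀ W ∈ constSpaces (nullMeans X R r) V 𝒞 T,
      (∃ μ₀ ∈ nullMeans X R r, affineLebesgue μ₀ W N = 0) →
      ∀ C : ℝ, size (nullMeans X R r) 𝒞 T C < 1 →
        constValue (nullMeans X R r) T W ≤ C ∧
        (C ≠ constValue (nullMeans X R r) T W → nullInf (nullMeans X R r) 𝒞 T C = 0)) ∧
    -- Part 3
    (∀ C : ℝ, nullInf (nullMeans X R r) 𝒞 T C = 0 →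
      (∀ μ₁ ∈ altMeans X R r,
        powerInfAtMean 𝒞 T C μ₁ = 0) ∧
      (∀ v ∈ Set.Ioi (0 : ℝ),
        powerInfAtVariance (altMeans X R r) 𝒞 T C v = 0)) := by
  have hpd := h𝒞.posDef
  obtain ⟨a, ha⟩ := nullMeans_nonempty X hR r
  have part2 : ∀ W ∈ constSpaces (nullMeans X R r) V 𝒞 T,
      (∃ μ₀ ∈ nullMeans X R r, affineLebesgue μ₀ W N = 0) →
      ∀ C : ℝ, size (nullMeans X R r) 𝒞 T C < 1 →
        constValue (nullMeans X R r) T W ≤ C ∧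
        (C ≠ constValue (nullMeans X R r) T W → nullInf (nullMeans X R r) 𝒞 T C = 0) := by
    rintro W ⟨hW, c, hc⟩ ⟨b, hb, hN⟩ C hC
    rw [constValue_eq hTmeas hTinv hc]
    have hc' := aeConstOn_forall hTmeas hTinv hc hb
    have hle : c ≤ C := by
      by_contra! hlt
      exact absurd hC (not_lt.2 (one_le_size_of_lt hpd hTmeas hNclosed hTcont hTinv hTV hdim hW
        hb hN hc' hlt))
    exact ⟨hle, fun hne => nullInf_eq_zero_of_lt hpd hTmeas hNclosed hTcont hTinv hTV hdim hW
      hb hN hc' (lt_of_le_of_ne hle hne.symm)⟩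
  refine ⟨?_, ?_, part2, fun C hC => ⟨fun μ₁ _ => ?_, fun v hv => ?_⟩⟩
  · rintro W - ⟨b, hb, hN⟩ μ₀ hμ₀
    exact affineLebesgue_eq_zero_of_invariant hNclosed.measurableSet hNinv hb hμ₀ hN
  · intro W₁ hW₁ W₂ hW₂ hne hN₁ hN₂ C hC
    -- `C` differs from at least one of the two concentration values.
    by_cases h : C = constValue (nullMeans X R r) T W₁
    · exact (part2 W₂ hW₂ hN₂ C hC).2 (h ▸ hne)
    · exact (part2 W₁ hW₁ hN₁ C hC).2 h
  · exact powerInfAtMean_eq_zero hpd hTmeas hTinv hC ⟨a, ha⟩ μ₁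
  · obtain ⟨d, hd, hd₁⟩ := exists_altMeans_seq X hq hR r ha
    exact powerInfAtVariance_eq_zero hpd hTmeas hTinv hC ha hd hd₁ hv
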